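/- Let $q\in\mathbb C$ with $0<|q|<1$, and write $(a;q)_n=\prod_{k=0}^{n-1}(1-aq^k)$, $(a;q)_\infty=\prod_{k=0}^{\infty}(1-aq^k)$, $(a,b;q)_n=(a;q)_n(b;q)_n$ (also for $n=\infty$), and $\binom{n}{k}_q=\frac{(q;q)_n}{(q;q)_k(q;q)_{n-k}}$ for integers $0\le k\le n$. For integers $m,n\ge 0$ and $z_1,z_2\in\mathbb C$ let $$h_{m,n}(z_1,z_2|q)=\sum_{j=0}^{\min(m,n)}\binom{m}{j}_q\binom{n}{j}_q q^{(m-j)(n-j)}(-1)^j(q;q)_j\,z_1^{m-j}z_2^{n-j},$$ and let the Schur polynomials be $$a_s(q)=\sum_{j\ge 0,\;2j\le s-2}q^{j^2+j}\binom{s-j-2}{j}_q\quad(s\ge 1),\qquad a_0(q)=1,\qquad b_s(q)=\sum_{j\ge 0,\;2j\le s-1}q^{j^2}\binom{s-j-1}{j}_q\quad(s\ge 0),$$ so that $a_1(q)=b_0(q)=0$ (empty sums). Let $s\ge 0$ be an integer and let $c,d,z_1,z_2\in\mathbb C$ satisfy $cd=-q^s$, $cz_1\ne q^{-r}$ and $dz_2\neq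 q^{-r}$ for all $r=0,1,2,\dots$. Then the double series below converges absolutely and $$\sum_{m,n=0}^{\infty}\frac{q^{m^2-mn+n^2}\,h_{m,n}(z_1,z_2|q)}{(q,cz_1q;q)_m\,(q,dz_2q;q)_n}\,c^m d^n=\frac{1}{(cz_1q,dz_2q;q)_\infty}\left[\frac{(-1)^s q^{-\binom s2}a_s(q)}{(q,q^4;q^5)_\infty}+\frac{(-1)^{s+1}q^{-\binom s2}b_s(q)}{(q^2,q^3;q^5)_\infty}\right].$$ -/

import Mathlib

noncomputable section

/-- The finite `q`-shifted factorial `(a; q)_n = ∏_{k=0}^{n-1} (1 - a q^k)`. -/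
def qShift (a q : ℂ) (n : ℕ) : ℂ := ∏ k ∈ Finset.range n, (1 - a * q ^ k)

/-- The infinite `q`-shifted factorial `(a; q)_∞ = ∏_{k=0}^∞ (1 - a q^k)`
(a convergent product whenever `‖q‖ < 1`). -/
def qShiftInf (a q : ℂ) : ℂ := ∏' k : ℕ, (1 - a * q ^ k)

/-- The Gaussian binomial coefficient `(q; q)_n / ((q; q)_k (q; q)_{n-k})`, zero for `k > n`. -/
def gaussBinom (q : ℂ) (n k : ℕ) : ℂ :=
  if k ≤ n then qShift q q n / (qShift q q k * qShift q q (n - k)) else 0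

/-- The second family of `q`-analogues of the 2D-Hermite polynomials, `h_{m,n}(z₁, z₂ | q)`. -/
def hPoly (q : ℂ) (m n : ℕ) (z₁ z₂ : ℂ) : ℂ :=
  ∑ j ∈ Finset.range (min m n + 1),
    gaussBinom q m j * gaussBinom q n j * q ^ ((m - j) * (n - j)) * (-1) ^ j * qShift q q j
      * z₁ ^ (m - j) * z₂ ^ (n - j)

/-- The Schur polynomial `a_m(q) = ∑_j q^{j²+j} [m-j-2 choose j]_q`, the sum being over those
`j ≥ 0` with `j ≤ m - j - 2`, with the customary initial value `a_0(q) = 1`. -/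
def schurA (q : ℂ) (m : ℕ) : ℂ :=
  if m = 0 then 1
  else ∑ j ∈ (Finset.range m).filter (fun j => 2 * j + 2 ≤ m),
    q ^ (j ^ 2 + j) * gaussBinom q (m - j - 2) j

/-- The Schur polynomial `b_m(q) = ∑_j q^{j²} [m-j-1 choose j]_q`, the sum being over those
`j ≥ 0` with `j ≤ m - j - 1`; in particular `b_0(q) = 0`. -/
def schurB (q : ℂ) (m : ℕ) : ℂ :=
  ∑ j ∈ (Finset.range m).filter (fun j => 2 * j + 1 ≤ m),
    q ^ (j ^ 2) * gaussBinom q (m - j - 1) j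

end

/-! Expand `hPoly` and put m = a + j, n = b + j. The factor q^(ab) cancels the cross term of m² - mn
+ n², leaving j² + (a² + aj) + (b² + bj), while (-1)^j (cd)^j = q^(sj). For fixed j the sums over a
and b separate (`term_eq_tripleTerm`). Each is a shifted Cauchy sum whose value 1/(xq; q)_∞, with x
= cz₁ or x = dz₂, does not depend on j (`hasSum_cauchy_shift`). What remains is `rogersSeries q s` =
∑ q^(j² + sj)/(q; q)_j.

That series obeys a three-term recurrence in s matching the one for the Schur polynomials, so it is
a combination of its values at s = 0 and s = 1 (`pow_mul_rogersSeries`). These are the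
Rogers-Ramanujan identities: Bailey's lemma applied twice to a unit Bailey pair, the limit N → ∞,
then the triple product in base q^5. The infinite identities are limits of finite ones, by Tannery's
theorem. -/

open Finset Filter Topology

/-! ### Shifted factorials, finite and infinite -/

theorem qShift_zero (a q : ℂ) : qShift a q 0 = 1 := by simp [qShift]

theorem qShift_succ (a q : ℂ) (n : ℕ) :
    qShift a q (n + 1) = qShift a q n * (1 - a * q ^ n) := by
  simp [qShift, prod_range_succ]

theorem qShift_succ' (a q : ℂ) (n : ℕ) :
    qShift a q (n + 1) = (1 - a) * qShift (a * q) q n := by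
  simp only [qShift, prod_range_succ', pow_zero, mul_one]
  rw [mul_comm]
  congr 1
  exact prod_congr rfl fun k _ => by ring

theorem qShift_add (a q : ℂ) (m n : ℕ) :
    qShift a q (m + n) = qShift a q m * qShift (a * q ^ m) q n := by
  simp only [qShift, prod_range_add]
  congr 1
  exact prod_congr rfl fun k _ => by ring

theorem one_sub_pow_ne_zero {q : ℂ} (hq : ‖q‖ < 1) {n : ℕ} (hn : n ≠ 0) : 1 - q ^ n ≠ 0 := by
  intro h
  have h1 : ‖q ^ n‖ < 1 := by
    rw [norm_pow]
    exact pow_lt_one₀ (norm_nonneg _) hq hn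
  rw [← sub_eq_zero.mp h] at h1
  simp at h1

theorem one_sub_mul_pow_ne_zero {q a : ℂ} (hq : ‖q‖ < 1) (ha : ‖a‖ < 1) (n : ℕ) :
    1 - a * q ^ n ≠ 0 := by
  intro h
  have h1 : ‖a * q ^ n‖ < 1 := by
    rw [norm_mul, norm_pow]
    exact mul_lt_one_of_nonneg_of_lt_one_left (norm_nonneg _) ha
      (pow_le_one₀ (norm_nonneg _) hq.le)
  rw [← sub_eq_zero.mp h] at h1
  simp at h1

theorem qShift_ne_zero {a q : ℂ} (h : ∀ k : ℕ, 1 - a * q ^ k ≠ 0) (n : ℕ) :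
    qShift a q n ≠ 0 := prod_ne_zero_iff.mpr fun k _ => h k

theorem qShift_self_ne_zero {q : ℂ} (hq : ‖q‖ < 1) (n : ℕ) : qShift q q n ≠ 0 :=
  qShift_ne_zero (one_sub_mul_pow_ne_zero hq hq) n

theorem summable_norm_mul_pow {q : ℂ} (hq : ‖q‖ < 1) (a : ℂ) :
    Summable fun k : ℕ => ‖-(a * q ^ k)‖ := by
  simp only [norm_neg, norm_mul, norm_pow]
  exact (summable_geometric_of_lt_one (norm_nonneg _) hq).mul_left _

theorem multipliable_qShift {q : ℂ} (hq : ‖q‖ < 1) (a : ℂ) :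
    Multipliable fun k : ℕ => 1 - a * q ^ k := by
  simpa only [sub_eq_add_neg] using
    multipliable_one_add_of_summable (f := fun k : ℕ => -(a * q ^ k)) (summable_norm_mul_pow hq a)

theorem tendsto_qShift {q : ℂ} (hq : ‖q‖ < 1) (a : ℂ) :
    Tendsto (qShift a q) atTop (𝓝 (qShiftInf a q)) :=
  (multipliable_qShift hq a).tendsto_prod_tprod_nat

theorem qShiftInf_ne_zero {q a : ℂ} (hq : ‖q‖ < 1) (h : ∀ k : ℕ, 1 - a * q ^ k ≠ 0) :
    qShiftInf a q ≠ 0 := by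
  have := tprod_one_add_ne_zero_of_summable (f := fun k : ℕ => -(a * q ^ k))
    (fun k => by simpa only [← sub_eq_add_neg] using h k) (summable_norm_mul_pow hq a)
  simp only [← sub_eq_add_neg] at this
  exact this

theorem qShiftInf_eq_mul {q : ℂ} (hq : ‖q‖ < 1) (a : ℂ) (m : ℕ) :
    qShiftInf a q = qShift a q m * qShiftInf (a * q ^ m) q := by
  refine tendsto_nhds_unique
    ((tendsto_add_atTop_iff_nat m).mpr (tendsto_qShift hq a)) ?_
  simpa only [add_comm _ m, qShift_add] using
    (tendsto_qShift hq (a * q ^ m)).const_mul (qShift a q m)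

theorem exists_norm_le_of_tendsto {f : ℕ → ℂ} {l : ℂ} (h : Tendsto f atTop (𝓝 l)) :
    ∃ C : ℝ, 0 ≤ C ∧ ∀ n, ‖f n‖ ≤ C := by
  obtain ⟨C, hC⟩ := h.norm.bddAbove_range
  have hC' : ∀ n, ‖f n‖ ≤ C := fun n => hC ⟨n, rfl⟩
  exact ⟨C, (norm_nonneg _).trans (hC' 0), hC'⟩

theorem tendsto_inv_qShift {q a : ℂ} (hq : ‖q‖ < 1) (h : ∀ k : ℕ, 1 - a * q ^ k ≠ 0) :
    Tendsto (fun n => (qShift a q n)⁻¹) atTop (𝓝 (qShiftInf a q)⁻¹) :=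
  (tendsto_qShift hq a).inv₀ (qShiftInf_ne_zero hq h)

/-! ### Summability and passage to the limit -/

theorem summable_pow_choose_mul_pow {r B : ℝ} (hr0 : 0 ≤ r) (hr1 : r < 1) (hB : 0 ≤ B) :
    Summable fun n : ℕ => r ^ n.choose 2 * B ^ n := by
  rcases hr0.eq_or_lt with rfl | hr0
  · refine summable_of_ne_finset_zero (s := range 2) fun n hn => ?_
    have : n.choose 2 ≠ 0 := (Nat.choose_pos (not_lt.mp (mt mem_range.mpr hn))).ne'
    simp [this]
  rcases hB.eq_or_lt with rfl | hB
  · refine summable_of_ne_finset_zero (s := range 1) fun n hn => ?_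
    have : n ≠ 0 := by simpa using hn
    simp [this]
  refine summable_of_ratio_test_tendsto_lt_one (l := 0) zero_lt_one
    (Eventually.of_forall fun n => by positivity) ?_
  have : (fun n : ℕ => ‖r ^ (n + 1).choose 2 * B ^ (n + 1)‖ / ‖r ^ n.choose 2 * B ^ n‖)
      = fun n => r ^ n * B := by
    ext n
    rw [Real.norm_of_nonneg (by positivity), Real.norm_of_nonneg (by positivity),
      Nat.choose_succ_succ' n 1, Nat.choose_one_right, div_eq_iff (by positivity)]
    ring
  rw [this]
  simpa using (tendsto_pow_atTop_nhds_zero_of_lt_one hr0.le hr1).mul_const B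

theorem sq_eq_two_mul_choose_add (n : ℕ) : n ^ 2 = 2 * n.choose 2 + n := by
  induction n with
  | zero => simp
  | succ n ih =>
    rw [Nat.choose_succ_succ' n 1, Nat.choose_one_right]
    nlinarith

theorem summable_norm_pow_sq_mul_pow {q : ℂ} (hq : ‖q‖ < 1) (x : ℂ) :
    Summable fun n : ℕ => ‖q ^ n ^ 2 * x ^ n‖ := by
  have h := summable_pow_choose_mul_pow (r := ‖q‖ ^ 2) (B := ‖q‖ * ‖x‖) (by positivity)
    (pow_lt_one₀ (norm_nonneg _) hq two_ne_zero) (by positivity)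
  refine h.congr fun n => ?_
  rw [norm_mul, norm_pow, norm_pow, sq_eq_two_mul_choose_add n]
  ring

/-- Tannery's theorem for triangular arrays of coefficients with a common column limit. -/
theorem tendsto_sum_range_mul {u : ℕ → ℂ} (hu : Summable fun k => ‖u k‖) {g : ℕ → ℕ → ℂ}
    {C : ℝ} {l : ℂ} (hC : ∀ N k, k ≤ N → ‖g N k‖ ≤ C)
    (hl : ∀ k, Tendsto (fun N => g N k) atTop (𝓝 l)) :
    Tendsto (fun N => ∑ k ∈ range (N + 1), u k * g N k) atTop (𝓝 ((∑' k, u k) * l)) := by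
  have hC0 : 0 ≤ C := (norm_nonneg _).trans (hC 0 0 le_rfl)
  have key := tendsto_tsum_of_dominated_convergence (𝓕 := atTop)
    (f := fun N k => if k ≤ N then u k * g N k else 0) (g := fun k => u k * l)
    (bound := fun k => ‖u k‖ * C) (hu.mul_right C) ?_ ?_
  · rw [tsum_mul_right] at key
    refine key.congr fun N => ?_
    rw [tsum_eq_sum (s := range (N + 1))]
    · exact sum_congr rfl fun k hk => if_pos (Nat.lt_succ_iff.mp (mem_range.mp hk))
    · intro k hk
      exact if_neg (by simpa [Nat.lt_succ_iff] using hk)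
  · intro k
    refine ((hl k).const_mul (u k)).congr' ?_
    filter_upwards [eventually_ge_atTop k] with N hN
    simp [hN]
  · refine Eventually.of_forall fun N k => ?_
    split_ifs with h
    · rw [norm_mul]
      exact mul_le_mul_of_nonneg_left (hC N k h) (norm_nonneg _)
    · simpa using mul_nonneg (norm_nonneg _) hC0

theorem tendsto_comp_sub {f : ℕ → ℂ} {l : ℂ} (h : Tendsto f atTop (𝓝 l)) (k : ℕ) :
    Tendsto (fun N => f (N - k)) atTop (𝓝 l) := h.comp (tendsto_sub_atTop_nat k)

theorem tendsto_comp_add {f : ℕ → ℂ} {l : ℂ} (h : Tendsto f atTop (𝓝 l)) (k : ℕ) :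
    Tendsto (fun N => f (N + k)) atTop (𝓝 l) := h.comp (tendsto_add_atTop_nat k)

/-! ### Gaussian binomials, the q-binomial theorem and Cauchy's identity -/

theorem gaussBinom_of_lt (q : ℂ) {n k : ℕ} (h : n < k) : gaussBinom q n k = 0 :=
  if_neg (not_le.mpr h)

theorem gaussBinom_of_le (q : ℂ) {n k : ℕ} (h : k ≤ n) :
    gaussBinom q n k = qShift q q n / (qShift q q k * qShift q q (n - k)) := if_pos h

theorem gaussBinom_zero_right {q : ℂ} (hq : ‖q‖ < 1) (n : ℕ) : gaussBinom q n 0 = 1 := by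
  rw [gaussBinom_of_le q (Nat.zero_le n), qShift_zero, one_mul, Nat.sub_zero,
    div_self (qShift_self_ne_zero hq n)]

theorem gaussBinom_self {q : ℂ} (hq : ‖q‖ < 1) (n : ℕ) : gaussBinom q n n = 1 := by
  rw [gaussBinom_of_le q le_rfl, Nat.sub_self, qShift_zero, mul_one,
    div_self (qShift_self_ne_zero hq n)]

theorem gaussBinom_succ_succ {q : ℂ} (hq : ‖q‖ < 1) (n k : ℕ) :
    gaussBinom q (n + 1) (k + 1) = gaussBinom q n (k + 1) + q ^ (n - k) * gaussBinom q n k := by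
  rcases lt_trichotomy n k with h | rfl | h
  · simp [gaussBinom_of_lt, h, h.trans (Nat.lt_succ_self k)]
  · simp [gaussBinom_self hq, gaussBinom_of_lt]
  · obtain ⟨m, rfl⟩ := Nat.exists_eq_add_of_lt h
    rw [gaussBinom_of_le q (by omega), gaussBinom_of_le q (by omega),
      gaussBinom_of_le q (by omega), show k + m + 1 + 1 - (k + 1) = m + 1 by omega,
      show k + m + 1 - (k + 1) = m by omega, show k + m + 1 - k = m + 1 by omega,
      qShift_succ q q (k + m + 1), qShift_succ q q k, qShift_succ q q m]
    have h1 := qShift_self_ne_zero hq k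
    have h2 := qShift_self_ne_zero hq m
    have h3 := one_sub_mul_pow_ne_zero hq hq k
    have h4 := one_sub_mul_pow_ne_zero hq hq m
    field_simp
    ring

theorem gaussBinom_succ_succ' {q : ℂ} (hq : ‖q‖ < 1) (n k : ℕ) :
    gaussBinom q (n + 1) (k + 1)
      = q ^ (k + 1) * gaussBinom q n (k + 1) + gaussBinom q n k := by
  rcases lt_trichotomy n k with h | rfl | h
  · simp [gaussBinom_of_lt, h, h.trans (Nat.lt_succ_self k)]
  · simp [gaussBinom_self hq, gaussBinom_of_lt]
  · obtain ⟨m, rfl⟩ := Nat.exists_eq_add_of_lt h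
    rw [gaussBinom_of_le q (by omega), gaussBinom_of_le q (by omega),
      gaussBinom_of_le q (by omega), show k + m + 1 + 1 - (k + 1) = m + 1 by omega,
      show k + m + 1 - (k + 1) = m by omega, show k + m + 1 - k = m + 1 by omega,
      qShift_succ q q (k + m + 1), qShift_succ q q k, qShift_succ q q m]
    have h1 := qShift_self_ne_zero hq k
    have h2 := qShift_self_ne_zero hq m
    have h3 := one_sub_mul_pow_ne_zero hq hq k
    have h4 := one_sub_mul_pow_ne_zero hq hq m
    field_simp
    ring

/-- The q-Pascal rule in summed form. It reduces the inductions for the q-binomial theorem and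
Cauchy's identity to termwise identities, with x replaced by xq. -/
theorem sum_gaussBinom_succ_mul {q : ℂ} (hq : ‖q‖ < 1) (n : ℕ) (f : ℕ → ℂ) :
    ∑ i ∈ range (n + 2), gaussBinom q (n + 1) i * f i
      = ∑ i ∈ range (n + 1), gaussBinom q n i * (q ^ i * f i + f (i + 1)) := by
  have h1 : ∑ i ∈ range (n + 1), gaussBinom q n i * (q ^ i * f i)
      = ∑ i ∈ range (n + 2), gaussBinom q n i * (q ^ i * f i) := by
    rw [sum_range_succ _ (n + 1), gaussBinom_of_lt q (Nat.lt_succ_self n), zero_mul, add_zero]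
  simp only [mul_add, sum_add_distrib]
  rw [h1, sum_range_succ', sum_range_succ' _ (n + 1)]
  simp only [gaussBinom_succ_succ' hq, gaussBinom_zero_right hq]
  rw [add_right_comm, ← sum_add_distrib]
  simp only [pow_zero, one_mul]
  congr 1
  exact sum_congr rfl fun i _ => by ring

/-- The finite `q`-binomial theorem. -/
theorem sum_gaussBinom_mul_pow {q : ℂ} (hq : ‖q‖ < 1) (n : ℕ) (x : ℂ) :
    ∑ i ∈ range (n + 1), gaussBinom q n i * ((-1) ^ i * q ^ i.choose 2 * x ^ i)
      = qShift x q n := by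
  induction n generalizing x with
  | zero => simp [gaussBinom_self hq, qShift_zero]
  | succ n ih =>
    rw [sum_gaussBinom_succ_mul hq, qShift_succ', ← ih, mul_sum]
    refine sum_congr rfl fun i _ => ?_
    rw [Nat.choose_succ_succ' i 1, Nat.choose_one_right]
    ring

/-- The finite form of Cauchy's identity. -/
theorem sum_gaussBinom_mul_pow_sq_div {q : ℂ} (hq : ‖q‖ < 1) (n : ℕ) (x : ℂ)
    (hx : ∀ k : ℕ, 1 - x * q * q ^ k ≠ 0) :
    ∑ i ∈ range (n + 1), gaussBinom q n i * (q ^ i ^ 2 * x ^ i / qShift (x * q) q i)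
      = (qShift (x * q) q n)⁻¹ := by
  induction n generalizing x with
  | zero => simp [gaussBinom_self hq, qShift_zero]
  | succ n ih =>
    have hx' : ∀ k : ℕ, 1 - x * q * q * q ^ k ≠ 0 := fun k => by
      have := hx (k + 1)
      rwa [pow_succ', ← mul_assoc] at this
    have h0 : 1 - x * q ≠ 0 := by simpa using hx 0
    rw [sum_gaussBinom_succ_mul hq, qShift_succ', mul_inv, ← ih (x * q) hx', mul_sum]
    refine sum_congr rfl fun i _ => ?_
    have h1 : qShift (x * q) q i = (1 - x * q) * qShift (x * q * q) q i / (1 - x * q * q ^ i) := by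
      rw [eq_div_iff (hx i), ← qShift_succ, qShift_succ']
    rw [qShift_succ', h1]
    have h2 := qShift_ne_zero hx' i
    have h3 := hx i
    field_simp
    ring

/-- Cauchy's identity. -/
theorem tsum_pow_sq_div_eq_inv {q : ℂ} (hq : ‖q‖ < 1) (x : ℂ)
    (hx : ∀ k : ℕ, 1 - x * q * q ^ k ≠ 0) :
    (Summable fun a : ℕ => ‖q ^ a ^ 2 * x ^ a / (qShift q q a * qShift (x * q) q a)‖) ∧
    ∑' a : ℕ, q ^ a ^ 2 * x ^ a / (qShift q q a * qShift (x * q) q a)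
      = (qShiftInf (x * q) q)⁻¹ := by
  have hqq := one_sub_mul_pow_ne_zero hq hq
  obtain ⟨C₁, hC₁, h₁⟩ := exists_norm_le_of_tendsto (tendsto_qShift hq q)
  obtain ⟨C₂, hC₂, h₂⟩ := exists_norm_le_of_tendsto (tendsto_inv_qShift hq hqq)
  obtain ⟨C₃, hC₃, h₃⟩ := exists_norm_le_of_tendsto (tendsto_inv_qShift hq hx)
  have hs : Summable fun a : ℕ => ‖q ^ a ^ 2 * x ^ a / (qShift q q a * qShift (x * q) q a)‖ := by
    refine ((summable_norm_pow_sq_mul_pow hq x).mul_right (C₂ * C₃)).of_nonneg_of_le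
      (fun _ => norm_nonneg _) fun a => ?_
    rw [div_eq_mul_inv, norm_mul, mul_inv, norm_mul (qShift q q a)⁻¹]
    gcongr
    exacts [h₂ a, h₃ a]
  refine ⟨hs, ?_⟩
  -- The weight (q; q)_N/(q; q)_{N-a} turns 1/(q; q)_a into a Gaussian binomial and tends to 1 for
  -- each fixed a.
  have key := tendsto_sum_range_mul hs
    (g := fun N a => qShift q q N * (qShift q q (N - a))⁻¹) (C := C₁ * C₂)
    (l := qShiftInf q q * (qShiftInf q q)⁻¹)
    (fun N k _ => by
      rw [norm_mul]
      gcongr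
      exacts [h₁ N, h₂ _])
    (fun k => (tendsto_qShift hq q).mul (tendsto_comp_sub (tendsto_inv_qShift hq hqq) k))
  rw [mul_inv_cancel₀ (qShiftInf_ne_zero hq hqq), mul_one] at key
  refine tendsto_nhds_unique key ((tendsto_inv_qShift hq hx).congr fun N => ?_)
  rw [← sum_gaussBinom_mul_pow_sq_div hq N x hx]
  refine sum_congr rfl fun a ha => ?_
  rw [gaussBinom_of_le q (Nat.lt_succ_iff.mp (mem_range.mp ha))]
  simp only [div_eq_mul_inv, mul_inv]
  ring

/-! ### Schur polynomials -/

/-- The common form `∑_j q^{j² + e j} [s - j choose j]_q` of the Schur polynomials. -/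
noncomputable def schurSum (q : ℂ) (e s : ℕ) : ℂ :=
  ∑ j ∈ range (s + 1), q ^ (j ^ 2 + e * j) * gaussBinom q (s - j) j

/-- Apply q-Pascal to the terms of index j + 1: the exponents (j+1)² + e(j+1) and s - 2j add up to
(j² + ej) + (s + 1 + e). -/
theorem schurSum_add_two {q : ℂ} (hq : ‖q‖ < 1) (e s : ℕ) :
    schurSum q e (s + 2) = schurSum q e (s + 1) + q ^ (s + 1 + e) * schurSum q e s := by
  rw [schurSum, sum_range_succ, gaussBinom_of_lt q (n := s + 2 - (s + 2)) (by omega), mul_zero,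
    add_zero, sum_range_succ' _ (s + 1), schurSum, sum_range_succ' _ (s + 1), schurSum, mul_sum,
    add_right_comm, ← sum_add_distrib]
  simp only [gaussBinom_zero_right hq]
  congr 1
  refine sum_congr rfl fun j hj => ?_
  have hj' : j ≤ s := Nat.lt_succ_iff.mp (mem_range.mp hj)
  rw [show s + 2 - (j + 1) = (s - j) + 1 by omega, show s + 1 - (j + 1) = s - j by omega,
    gaussBinom_succ_succ hq]
  rcases lt_or_ge (s - j) j with h | h
  · simp [gaussBinom_of_lt q h]
  · obtain ⟨m, rfl⟩ := Nat.exists_eq_add_of_le (show 2 * j ≤ s by omega)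
    rw [show 2 * j + m - j - j = m by omega]
    ring

theorem schurA_add_two (q : ℂ) (s : ℕ) : schurA q (s + 2) = schurSum q 1 s := by
  rw [schurA, if_neg (by omega), sum_filter, schurSum, sum_range_succ, if_neg (by omega), add_zero]
  refine sum_congr rfl fun j hj => ?_
  rw [one_mul, show s + 2 - j - 2 = s - j by omega]
  split_ifs with h
  · rfl
  · rw [gaussBinom_of_lt q (by omega), mul_zero]

theorem schurB_add_one (q : ℂ) (s : ℕ) : schurB q (s + 1) = schurSum q 0 s := by
  rw [schurB, sum_filter, schurSum]
  refine sum_congr rfl fun j hj => ?_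
  have := mem_range.mp hj
  rw [zero_mul, add_zero, show s + 1 - j - 1 = s - j by omega]
  split_ifs with h
  · rfl
  · rw [gaussBinom_of_lt q (by omega), mul_zero]

theorem schurSum_zero {q : ℂ} (hq : ‖q‖ < 1) (e : ℕ) : schurSum q e 0 = 1 := by
  simp [schurSum, gaussBinom_zero_right hq]

theorem schurSum_one {q : ℂ} (hq : ‖q‖ < 1) (e : ℕ) : schurSum q e 1 = 1 := by
  simp [schurSum, sum_range_succ, gaussBinom_zero_right hq, gaussBinom_of_lt]

theorem schurA_zero (q : ℂ) : schurA q 0 = 1 := by simp [schurA]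

theorem schurA_one (q : ℂ) : schurA q 1 = 0 := by simp [schurA]

theorem schurB_zero (q : ℂ) : schurB q 0 = 0 := by simp [schurB]

/-- The conventions a_0 = 1 and a_1 = 0 extend the recurrence down to s = 0; those cases are
separate because the `schurSum` form only starts at index 2. -/
theorem schurA_rec {q : ℂ} (hq : ‖q‖ < 1) (s : ℕ) :
    schurA q (s + 2) = schurA q (s + 1) + q ^ s * schurA q s := by
  match s with
  | 0 => rw [schurA_add_two, schurA_one, schurA_zero, schurSum_zero hq]; simp
  | 1 => rw [schurA_add_two, schurA_add_two q 0, schurA_one, schurSum_zero hq, schurSum_one hq]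
         simp
  | s + 2 =>
    rw [schurA_add_two, show s + 2 + 1 = s + 1 + 2 by rfl, schurA_add_two, schurA_add_two,
      schurSum_add_two hq]

theorem schurB_rec {q : ℂ} (hq : ‖q‖ < 1) (s : ℕ) :
    schurB q (s + 2) = schurB q (s + 1) + q ^ s * schurB q s := by
  match s with
  | 0 => rw [schurB_add_one, schurB_add_one, schurB_zero, schurSum_zero hq, schurSum_one hq]; simp
  | s + 1 =>
    rw [schurB_add_one, schurB_add_one, schurB_add_one, schurSum_add_two hq]

/-! ### Bailey's lemma and the unit Bailey pairs -/

/-- Finite Cauchy at x = q^(2k+e), after splitting (q; q)_{a+2k+e} at 2k + e. This is the inner sum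
once the summations in Bailey's lemma are interchanged. -/
theorem sum_pow_sq_div_qShift {q : ℂ} (hq : ‖q‖ < 1) (e k M : ℕ) :
    ∑ a ∈ range (M + 1), q ^ ((k + a) ^ 2 + e * (k + a)) * (qShift q q (M - a))⁻¹
        * ((qShift q q a)⁻¹ * (qShift q q (a + 2 * k + e))⁻¹)
      = q ^ (k ^ 2 + e * k) * ((qShift q q M)⁻¹ * (qShift q q (M + 2 * k + e))⁻¹) := by
  have hx : ∀ r : ℕ, 1 - q ^ (2 * k + e) * q * q ^ r ≠ 0 := fun r => by
    rw [← pow_succ, ← pow_add]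
    exact one_sub_pow_ne_zero hq (by omega)
  have hsplit : ∀ a, qShift q q (a + 2 * k + e)
      = qShift q q (2 * k + e) * qShift (q ^ (2 * k + e) * q) q a := fun a => by
    rw [show a + 2 * k + e = 2 * k + e + a by ring, qShift_add, mul_comm q]
  have hM := qShift_self_ne_zero hq M
  rw [hsplit, mul_inv, ← sum_gaussBinom_mul_pow_sq_div hq M _ hx, mul_sum, mul_sum, mul_sum]
  refine sum_congr rfl fun a ha => ?_
  rw [hsplit, gaussBinom_of_le q (Nat.lt_succ_iff.mp (mem_range.mp ha))]
  have h1 := qShift_self_ne_zero hq (2 * k + e)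
  have h2 := qShift_ne_zero hx a
  have h3 := qShift_self_ne_zero hq a
  have h4 := qShift_self_ne_zero hq (M - a)
  field_simp
  ring

/-- The limiting case of Bailey's lemma, relative to `a = q ^ e`. -/
theorem sum_bailey {q : ℂ} (hq : ‖q‖ < 1) (e N : ℕ) (w : ℕ → ℂ) :
    ∑ s ∈ range (N + 1), q ^ (s ^ 2 + e * s) * (qShift q q (N - s))⁻¹
        * ∑ k ∈ range (s + 1), w k * ((qShift q q (s - k))⁻¹ * (qShift q q (s + k + e))⁻¹)
      = ∑ k ∈ range (N + 1), w k * q ^ (k ^ 2 + e * k)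
          * ((qShift q q (N - k))⁻¹ * (qShift q q (N + k + e))⁻¹) := by
  simp only [mul_sum]
  rw [sum_comm' (t' := range (N + 1)) (s' := fun k => Ico k (N + 1))
    (fun s k => by simp only [mem_range, mem_Ico]; omega)]
  refine sum_congr rfl fun k hk => ?_
  have hk' : k ≤ N := Nat.lt_succ_iff.mp (mem_range.mp hk)
  obtain ⟨M, rfl⟩ := Nat.exists_eq_add_of_le hk'
  rw [sum_Ico_eq_sum_range, show k + M + 1 - k = M + 1 by omega, mul_assoc,
    show k + M - k = M by omega, show k + M + k + e = M + 2 * k + e by ring,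
    ← sum_pow_sq_div_qShift hq, mul_sum]
  refine sum_congr rfl fun a _ => ?_
  rw [show k + M - (k + a) = M - a by omega, show k + a - k = a by omega,
    show k + a + k + e = a + 2 * k + e by ring]
  ring

/-- The first application collapses to its s = 0 term, namely 1/(q; q)_N; the second starts from
that new pair. -/
theorem sum_bailey_twice {q : ℂ} (hq : ‖q‖ < 1) (e N : ℕ) (w : ℕ → ℂ)
    (hw : ∀ s, ∑ k ∈ range (s + 1), w k * ((qShift q q (s - k))⁻¹ * (qShift q q (s + k + e))⁻¹)
      = if s = 0 then 1 else 0) :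
    ∑ s ∈ range (N + 1), q ^ (s ^ 2 + e * s) * (qShift q q s)⁻¹ * (qShift q q (N - s))⁻¹
      = ∑ k ∈ range (N + 1), w k * q ^ (2 * (k ^ 2 + e * k))
          * ((qShift q q (N - k))⁻¹ * (qShift q q (N + k + e))⁻¹) := by
  have h := sum_bailey hq e N (fun k => w k * q ^ (k ^ 2 + e * k))
  simp only [two_mul, pow_add _ (_ + _) (_ + _), ← mul_assoc (w _)]
  rw [← h]
  refine sum_congr rfl fun s _ => ?_
  rw [← sum_bailey hq e s w]
  simp only [hw]
  rw [sum_eq_single_of_mem 0 (by simp) (fun t _ ht => by simp [ht])]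
  simp
  ring

/-- Bilateral weights of the unit Bailey pair relative to `1`, folded onto `ℕ`. -/
def unitWeightOne (q : ℂ) (k : ℕ) : ℂ :=
  if k = 0 then 1 else (-1) ^ k * q ^ k.choose 2 * (1 + q ^ k)

/-- Bilateral weights of the unit Bailey pair relative to `q`, folded onto `ℕ`. -/
def unitWeightQ (q : ℂ) (k : ℕ) : ℂ :=
  (-1) ^ k * q ^ k.choose 2 * (1 - q ^ (2 * k + 1))

theorem choose_succ_two (k : ℕ) : (k + 1).choose 2 = k + k.choose 2 := by
  rw [Nat.choose_succ_succ' k 1, Nat.choose_one_right]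

/-- The partial sums telescope to a closed form. The bound K ≤ s keeps s - K untruncated, so the
term k = s is added separately in `sum_unitWeightQ`. -/
theorem sum_range_unitWeightQ {q : ℂ} (hq : ‖q‖ < 1) {s : ℕ} (hs : s ≠ 0) {K : ℕ} (hK : K ≤ s) :
    ∑ k ∈ range K, unitWeightQ q k * ((qShift q q (s - k))⁻¹ * (qShift q q (s + k + 1))⁻¹)
      = -((-1) ^ K * q ^ K.choose 2 * (1 - q ^ K) * (1 - q ^ s)⁻¹
          * ((qShift q q (s - K))⁻¹ * (qShift q q (s + K))⁻¹)) := by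
  induction K with
  | zero => simp
  | succ K ih =>
    rw [sum_range_succ, ih (by omega), unitWeightQ, choose_succ_two]
    obtain ⟨m, rfl⟩ := Nat.exists_eq_add_of_le hK
    rw [show K + 1 + m - K = m + 1 by omega, show K + 1 + m - (K + 1) = m by omega,
      ← add_assoc (K + 1 + m) K 1,
      qShift_succ q q m, qShift_succ q q (K + 1 + m + K)]
    have h0 := one_sub_pow_ne_zero hq hs
    have h1 := qShift_self_ne_zero hq m
    have h2 := qShift_self_ne_zero hq (K + 1 + m + K)
    have h3 := one_sub_mul_pow_ne_zero hq hq m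
    have h4 := one_sub_mul_pow_ne_zero hq hq (K + 1 + m + K)
    field_simp
    ring

theorem sum_unitWeightQ {q : ℂ} (hq : ‖q‖ < 1) (s : ℕ) :
    ∑ k ∈ range (s + 1), unitWeightQ q k
        * ((qShift q q (s - k))⁻¹ * (qShift q q (s + k + 1))⁻¹)
      = if s = 0 then 1 else 0 := by
  split_ifs with hs
  · subst hs
    have h0 : 1 - q ≠ 0 := by simpa using one_sub_pow_ne_zero hq one_ne_zero
    simp [unitWeightQ, qShift, h0]
  · rw [sum_range_succ, sum_range_unitWeightQ hq hs le_rfl, unitWeightQ, qShift_succ]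
    have h0 := one_sub_pow_ne_zero hq hs
    have h2 := qShift_self_ne_zero hq (s + s)
    have h4 := one_sub_mul_pow_ne_zero hq hq (s + s)
    have h5 := qShift_self_ne_zero hq (s - s)
    field_simp
    ring

/-- The same telescoping, started at K = 1 because the weight at 0 is exceptional. The factor 1 -
q^(s+K) is written to match the last factor of (q; q)_{s+K}. -/
theorem sum_range_unitWeightOne {q : ℂ} (hq : ‖q‖ < 1) {s : ℕ} (hs : s ≠ 0) {K : ℕ}
    (hK0 : 1 ≤ K) (hK : K ≤ s) :
    ∑ k ∈ range K, unitWeightOne q k * ((qShift q q (s - k))⁻¹ * (qShift q q (s + k + 0))⁻¹)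
      = -((-1) ^ K * q ^ K.choose 2 * (1 - q * q ^ (s + K - 1)) * (1 - q ^ s)⁻¹
          * ((qShift q q (s - K))⁻¹ * (qShift q q (s + K))⁻¹)) := by
  induction K, hK0 using Nat.le_induction with
  | base =>
    obtain ⟨m, rfl⟩ := Nat.exists_eq_succ_of_ne_zero hs
    have h0 := one_sub_pow_ne_zero hq hs
    have h1 := qShift_self_ne_zero hq m
    have h3 := one_sub_mul_pow_ne_zero hq hq m
    have h4 := one_sub_mul_pow_ne_zero hq hq (m + 1)
    simp only [sum_range_one, unitWeightOne, Nat.succ_eq_add_one, qShift_succ, Nat.add_sub_cancel,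
      Nat.sub_zero, add_zero, if_true] at h0 ⊢
    rw [pow_succ'] at h0
    simp only [pow_succ'] at h4 ⊢
    have h5 : 1 - q ^ 2 * q ^ m ≠ 0 := by rwa [pow_two, mul_assoc]
    field_simp
    simp
  | succ K hK0 ih =>
    rw [sum_range_succ, ih (by omega), unitWeightOne, if_neg (by omega), choose_succ_two]
    obtain ⟨m, rfl⟩ := Nat.exists_eq_add_of_le hK
    obtain ⟨L, rfl⟩ := Nat.exists_eq_add_of_le' hK0
    rw [show L + 1 + 1 + m - (L + 1) = m + 1 by omega,
      show L + 1 + 1 + m - (L + 1 + 1) = m by omega,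
      show L + 1 + 1 + m + (L + 1 + 1) - 1 = L + 1 + 1 + m + (L + 1) by omega,
      show L + 1 + 1 + m + (L + 1) - 1 = L + 1 + 1 + m + L by omega,
      ← add_assoc (L + 1 + 1 + m) (L + 1) 1, add_zero,
      qShift_succ q q m, qShift_succ q q (L + 1 + 1 + m + (L + 1))]
    have h0 := one_sub_pow_ne_zero hq hs
    have h1 := qShift_self_ne_zero hq m
    have h2 := qShift_self_ne_zero hq (L + 1 + 1 + m + (L + 1))
    have h3 := one_sub_mul_pow_ne_zero hq hq m
    have h4 := one_sub_mul_pow_ne_zero hq hq (L + 1 + 1 + m + (L + 1))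
    field_simp
    ring

theorem sum_unitWeightOne {q : ℂ} (hq : ‖q‖ < 1) (s : ℕ) :
    ∑ k ∈ range (s + 1), unitWeightOne q k
        * ((qShift q q (s - k))⁻¹ * (qShift q q (s + k + 0))⁻¹)
      = if s = 0 then 1 else 0 := by
  split_ifs with hs
  · subst hs
    simp [unitWeightOne, qShift]
  · rw [sum_range_succ, sum_range_unitWeightOne hq hs (by omega) le_rfl, unitWeightOne, if_neg hs,
      add_zero, ← pow_succ', show s + s - 1 + 1 = s + s by omega]
    have h0 := one_sub_pow_ne_zero hq hs
    have h2 := qShift_self_ne_zero hq (s + s)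
    have h5 := qShift_self_ne_zero hq (s - s)
    field_simp
    ring

theorem norm_unitWeightQ_le {q : ℂ} (hq : ‖q‖ < 1) (k : ℕ) : ‖unitWeightQ q k‖ ≤ 2 := by
  have h1 : ∀ n : ℕ, ‖q ^ n‖ ≤ 1 := fun n => by
    rw [norm_pow]; exact pow_le_one₀ (norm_nonneg _) hq.le
  rw [unitWeightQ, norm_mul, norm_mul, norm_pow, norm_neg, norm_one, one_pow, one_mul]
  calc _ ≤ 1 * (‖(1 : ℂ)‖ + ‖q ^ (2 * k + 1)‖) := by
        gcongr
        exacts [h1 _, norm_sub_le _ _]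
    _ ≤ 2 := by rw [norm_one]; linarith [h1 (2 * k + 1)]

theorem norm_unitWeightOne_le {q : ℂ} (hq : ‖q‖ < 1) (k : ℕ) : ‖unitWeightOne q k‖ ≤ 2 := by
  have h1 : ∀ n : ℕ, ‖q ^ n‖ ≤ 1 := fun n => by
    rw [norm_pow]; exact pow_le_one₀ (norm_nonneg _) hq.le
  rw [unitWeightOne]
  split_ifs
  · simp
  rw [norm_mul, norm_mul, norm_pow, norm_neg, norm_one, one_pow, one_mul]
  calc _ ≤ 1 * (‖(1 : ℂ)‖ + ‖q ^ k‖) := by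
        gcongr
        exacts [h1 _, norm_add_le _ _]
    _ ≤ 2 := by rw [norm_one]; linarith [h1 k]

theorem summable_pow_sq_add_div {q : ℂ} (hq : ‖q‖ < 1) (e : ℕ) :
    Summable fun n : ℕ => ‖q ^ (n ^ 2 + e * n) * (qShift q q n)⁻¹‖ := by
  obtain ⟨C, hC0, hC⟩ := exists_norm_le_of_tendsto
    (tendsto_inv_qShift hq (one_sub_mul_pow_ne_zero hq hq))
  refine ((summable_norm_pow_sq_mul_pow hq (q ^ e)).mul_right C).of_nonneg_of_le
    (fun _ => norm_nonneg _) fun n => ?_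
  rw [norm_mul, pow_add, pow_mul]
  exact mul_le_mul_of_nonneg_left (hC n) (norm_nonneg _)

/-- The sum side of the Rogers-Ramanujan identities as a theta series. -/
theorem tsum_pow_sq_add_div {q : ℂ} (hq : ‖q‖ < 1) (e : ℕ) (w : ℕ → ℂ) (hw2 : ∀ k, ‖w k‖ ≤ 2)
    (hw : ∀ s, ∑ k ∈ range (s + 1), w k * ((qShift q q (s - k))⁻¹ * (qShift q q (s + k + e))⁻¹)
      = if s = 0 then 1 else 0) :
    (Summable fun k => ‖w k * q ^ (2 * (k ^ 2 + e * k))‖) ∧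
    ∑' n : ℕ, q ^ (n ^ 2 + e * n) * (qShift q q n)⁻¹
      = (∑' k : ℕ, w k * q ^ (2 * (k ^ 2 + e * k))) * (qShiftInf q q)⁻¹ := by
  have hqq := one_sub_mul_pow_ne_zero hq hq
  have hlim := tendsto_inv_qShift hq hqq
  obtain ⟨C, hC0, hC⟩ := exists_norm_le_of_tendsto hlim
  have hs : Summable fun k => ‖w k * q ^ (2 * (k ^ 2 + e * k))‖ := by
    refine ((summable_norm_pow_sq_mul_pow (q := q ^ 2)
      (by rw [norm_pow]; exact pow_lt_one₀ (norm_nonneg _) hq two_ne_zero)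
      (q ^ (2 * e))).mul_left 2).of_nonneg_of_le (fun _ => norm_nonneg _) fun n => ?_
    rw [norm_mul]
    refine mul_le_mul (hw2 n) (le_of_eq ?_) (norm_nonneg _) zero_le_two
    congr 1
    ring
  refine ⟨hs, ?_⟩
  -- The two sides of `sum_bailey_twice` tend to the series times 1/(q; q)_∞ and to the theta series
  -- times 1/(q; q)_∞²; one factor cancels.
  have k1 := tendsto_sum_range_mul (summable_pow_sq_add_div hq e)
    (g := fun N a => (qShift q q (N - a))⁻¹) (fun N k _ => hC _)
    (fun k => tendsto_comp_sub hlim k)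
  have k2 := tendsto_sum_range_mul hs (C := C * C)
    (g := fun N k => (qShift q q (N - k))⁻¹ * (qShift q q (N + k + e))⁻¹)
    (fun N k _ => by
      rw [norm_mul]
      gcongr
      exacts [hC _, hC _])
    (fun k => (tendsto_comp_sub hlim k).mul
      (by simpa only [add_assoc] using tendsto_comp_add hlim (k + e)))
  have := tendsto_nhds_unique (k1.congr fun N => sum_bailey_twice hq e N w hw) k2
  rw [← mul_assoc] at this
  exact mul_right_cancel₀ (inv_ne_zero (qShiftInf_ne_zero hq hqq)) this

/-! ### The Jacobi triple product -/

/-- Each factor 1 - z p^(-i) equals -z p^(-i) (1 - w p^(i-1)), since p/z = w. -/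
theorem qShift_div_pow {p z w : ℂ} (hzw : z * w = p) (hz : z ≠ 0) (hp : p ≠ 0) (N : ℕ) :
    qShift (z / p ^ N) p N * p ^ (N + 1).choose 2 = (-1) ^ N * z ^ N * qShift w p N := by
  induction N with
  | zero => simp [qShift_zero]
  | succ N ih =>
    have h1 : z / p ^ (N + 1) * p = z / p ^ N := by
      rw [pow_succ]
      field_simp
    rw [qShift_succ', h1, qShift_succ w, choose_succ_two (N + 1), pow_add]
    have h2 : (1 - z / p ^ (N + 1)) * p ^ (N + 1) = -z * (1 - w * p ^ N) := by
      rw [sub_mul, div_mul_cancel₀ _ (pow_ne_zero _ hp), pow_succ]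
      linear_combination (-p ^ N) * hzw
    linear_combination (1 - z / p ^ (N + 1)) * p ^ (N + 1) * ih
      + (-1) ^ N * z ^ N * qShift w p N * h2

theorem choose_two_add_identity (N k : ℕ) :
    (N + k).choose 2 + (N + 1).choose 2 = k.choose 2 + N * (N + k) := by
  have h1 := sq_eq_two_mul_choose_add (N + k)
  have h2 := sq_eq_two_mul_choose_add (N + 1)
  have h3 := sq_eq_two_mul_choose_add k
  nlinarith

theorem choose_two_sub_identity (M k : ℕ) :
    M.choose 2 + (M + k + 1 + 1).choose 2 = (k + 1).choose 2 + (k + 1) + (M + k + 1) * M := by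
  have h1 := sq_eq_two_mul_choose_add M
  have h2 := sq_eq_two_mul_choose_add (M + k + 1 + 1)
  have h3 := sq_eq_two_mul_choose_add (k + 1)
  nlinarith

/-- The finite form of the Jacobi triple product. -/
theorem qShift_mul_qShift_eq_sum {p z w : ℂ} (hp1 : ‖p‖ < 1) (hzw : z * w = p) (hp : p ≠ 0)
    (N : ℕ) :
    qShift z p N * qShift w p N
      = ∑ k ∈ range (N + 1), (-1) ^ k * p ^ k.choose 2 * z ^ k
          * (qShift p p (N + N) * ((qShift p p (N + k))⁻¹ * (qShift p p (N - k))⁻¹))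
        - ∑ k ∈ range N, (-1) ^ k * p ^ (k + 1).choose 2 * w ^ (k + 1)
          * (qShift p p (N + N) * ((qShift p p (N - 1 - k))⁻¹ * (qShift p p (N + 1 + k))⁻¹)) := by
  have hz : z ≠ 0 := left_ne_zero_of_mul (hzw ▸ hp)
  have hc : (-1 : ℂ) ^ N * z ^ N ≠ 0 := mul_ne_zero (pow_ne_zero _ (by norm_num)) (pow_ne_zero _ hz)
  have hpN : p ^ N ≠ 0 := pow_ne_zero _ hp
  apply mul_left_cancel₀ hc
  -- The q-binomial theorem of order 2N, centred at z p^(-N): product and sum both split at N, and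
  -- the lower half of the sum is reflected to give the negative powers of z.
  have h1 := sum_gaussBinom_mul_pow hp1 (N + N) (z / p ^ N)
  rw [qShift_add, div_mul_cancel₀ _ hpN, add_assoc, sum_range_add, ← sum_range_reflect _ N] at h1
  have h2 := qShift_div_pow hzw hz hp N
  calc (-1) ^ N * z ^ N * (qShift z p N * qShift w p N)
      = (qShift (z / p ^ N) p N * qShift z p N) * p ^ (N + 1).choose 2 := by
        linear_combination (-qShift z p N) * h2
    _ = _ := by
        rw [← h1, add_comm, add_mul, mul_sub, sub_eq_add_neg, sum_mul, sum_mul, mul_sum, mul_sum,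
          ← sum_neg_distrib]
        congr 1
        · refine sum_congr rfl fun k hk => ?_
          have hk' : k ≤ N := Nat.lt_succ_iff.mp (mem_range.mp hk)
          rw [gaussBinom_of_le p (by omega), show N + N - (N + k) = N - k by omega, div_pow,
            ← pow_mul]
          have h3 : p ^ (N + k).choose 2 * p ^ (N + 1).choose 2
              = p ^ k.choose 2 * p ^ (N * (N + k)) := by
            rw [← pow_add, ← pow_add, choose_two_add_identity]
          have h4 : p ^ (N * (N + k)) ≠ 0 := pow_ne_zero _ hp
          have h5 := qShift_self_ne_zero hp1 (N + k)
          have h6 := qShift_self_ne_zero hp1 (N - k)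
          field_simp
          linear_combination qShift p p (N + N) * (-1) ^ (N + k) * z ^ (N + k) * h3
        · refine sum_congr rfl fun k hk => ?_
          obtain ⟨M, rfl⟩ := Nat.exists_eq_add_of_lt (mem_range.mp hk)
          rw [show k + M + 1 - 1 - k = M by omega, show k + M + 1 = M + k + 1 by ring,
            gaussBinom_of_le p (by omega),
            show M + k + 1 + (M + k + 1) - M = M + k + 1 + 1 + k by omega, div_pow, ← pow_mul]
          -- Here z^(k+1) w^(k+1) = p^(k+1) trades negative powers of z for positive powers of w.
          have h3 : p ^ M.choose 2 * p ^ (M + k + 1 + 1).choose 2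
              = p ^ (k + 1).choose 2 * (z ^ (k + 1) * w ^ (k + 1)) * p ^ ((M + k + 1) * M) := by
            rw [← mul_pow, hzw, ← pow_add, ← pow_add, ← pow_add, choose_two_sub_identity]
          have h4 : p ^ ((M + k + 1) * M) ≠ 0 := pow_ne_zero _ hp
          have h5 := qShift_self_ne_zero hp1 M
          have h6 := qShift_self_ne_zero hp1 (M + k + 1 + 1 + k)
          have h7 : (-1 : ℂ) ^ (M + k + 1) * (-1) ^ k = -(-1) ^ M := by
            rw [show M + k + 1 = M + (k + 1) by ring, pow_add, pow_succ, mul_assoc,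
              mul_right_comm, ← mul_pow]
            simp
          field_simp
          linear_combination qShift p p (M + k + 1 + (M + k + 1)) * (-1) ^ M * z ^ M * h3
            + qShift p p (M + k + 1 + (M + k + 1)) * p ^ ((M + k + 1) * M) * z ^ (M + k + 1) * p ^ (k + 1).choose 2 * w ^ (k + 1) * h7

theorem summable_norm_theta {p : ℂ} (hp1 : ‖p‖ < 1) (z : ℂ) :
    Summable fun k : ℕ => ‖(-1) ^ k * p ^ k.choose 2 * z ^ k‖ := by
  refine (summable_pow_choose_mul_pow (norm_nonneg p) hp1 (norm_nonneg z)).congr fun k => ?_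
  simp

theorem summable_norm_theta_succ {p : ℂ} (hp1 : ‖p‖ < 1) (w : ℂ) :
    Summable fun k : ℕ => ‖(-1) ^ k * p ^ (k + 1).choose 2 * w ^ (k + 1)‖ := by
  refine ((summable_nat_add_iff 1).mpr (summable_norm_theta hp1 w)).congr fun k => ?_
  simp

/-- The Jacobi triple product identity. -/
theorem jacobi_triple_product {p z w : ℂ} (hp1 : ‖p‖ < 1) (hzw : z * w = p) (hp : p ≠ 0) :
    (∑' k : ℕ, (-1) ^ k * p ^ k.choose 2 * z ^ k)
      - ∑' k : ℕ, (-1) ^ k * p ^ (k + 1).choose 2 * w ^ (k + 1)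
      = qShiftInf z p * qShiftInf w p * qShiftInf p p := by
  have hpp := one_sub_mul_pow_ne_zero hp1 hp1
  have hI := qShiftInf_ne_zero hp1 hpp
  have hlim := tendsto_qShift hp1 p
  have hinv := tendsto_inv_qShift hp1 hpp
  obtain ⟨C, hC0, hC⟩ := exists_norm_le_of_tendsto hlim
  obtain ⟨D, hD0, hD⟩ := exists_norm_le_of_tendsto hinv
  have hdbl : Tendsto (fun N => qShift p p (N + N)) atTop (𝓝 (qShiftInf p p)) :=
    hlim.comp (tendsto_atTop_mono (fun N => Nat.le_add_left N N) tendsto_id)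
  have hbd : ∀ a b c, ‖qShift p p a * ((qShift p p b)⁻¹ * (qShift p p c)⁻¹)‖ ≤ C * (D * D) :=
    fun a b c => by
      rw [norm_mul, norm_mul]
      gcongr
      exacts [hC _, hD _, hD _]
  have k1 := tendsto_sum_range_mul (summable_norm_theta hp1 z)
    (g := fun N k => qShift p p (N + N) * ((qShift p p (N + k))⁻¹ * (qShift p p (N - k))⁻¹))
    (fun N k _ => hbd _ _ _)
    (fun k => hdbl.mul ((tendsto_comp_add hinv k).mul (tendsto_comp_sub hinv k)))
  -- The second finite sum runs over `range N`, so the identity is used at N + 1.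
  have k2 := tendsto_sum_range_mul (summable_norm_theta_succ hp1 w)
    (g := fun N k => qShift p p (N + 1 + (N + 1))
      * ((qShift p p (N - k))⁻¹ * (qShift p p (N + 1 + 1 + k))⁻¹))
    (fun N k _ => hbd _ _ _)
    (fun k => (hdbl.comp (tendsto_add_atTop_nat 1)).mul ((tendsto_comp_sub hinv k).mul
      (by simpa only [add_assoc] using tendsto_comp_add hinv (1 + (1 + k)))))
  have k3 := (k1.comp (tendsto_add_atTop_nat 1)).sub k2
  have k4 := ((tendsto_qShift hp1 z).mul (tendsto_qShift hp1 w)).comp (tendsto_add_atTop_nat 1)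
  have := tendsto_nhds_unique k3 (k4.congr fun N => qShift_mul_qShift_eq_sum hp1 hzw hp (N + 1))
  rw [← this]
  field_simp

/-! ### The Rogers-Ramanujan identities and their extension to all s -/

theorem qShift_mul_five (q : ℂ) (N : ℕ) :
    qShift q q (5 * N) = qShift q (q ^ 5) N * qShift (q ^ 2) (q ^ 5) N * qShift (q ^ 3) (q ^ 5) N
      * qShift (q ^ 4) (q ^ 5) N * qShift (q ^ 5) (q ^ 5) N := by
  induction N with
  | zero => simp [qShift_zero]
  | succ N ih =>
    simp only [show 5 * (N + 1) = 5 * N + 1 + 1 + 1 + 1 + 1 by ring, qShift_succ, ih]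
    ring

theorem norm_pow_lt_one {q : ℂ} (hq : ‖q‖ < 1) {n : ℕ} (hn : n ≠ 0) : ‖q ^ n‖ < 1 := by
  rw [norm_pow]
  exact pow_lt_one₀ (norm_nonneg _) hq hn

theorem qShiftInf_five {q : ℂ} (hq : ‖q‖ < 1) :
    qShiftInf q q = qShiftInf q (q ^ 5) * qShiftInf (q ^ 2) (q ^ 5) * qShiftInf (q ^ 3) (q ^ 5)
      * qShiftInf (q ^ 4) (q ^ 5) * qShiftInf (q ^ 5) (q ^ 5) := by
  have h5 := norm_pow_lt_one hq (n := 5) (by norm_num)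
  have h1 : Tendsto (fun N => qShift q q (5 * N)) atTop (𝓝 (qShiftInf q q)) :=
    (tendsto_qShift hq q).comp (tendsto_atTop_mono (fun N => by simp only [id]; omega) tendsto_id)
  refine tendsto_nhds_unique h1 (Tendsto.congr (fun N => (qShift_mul_five q N).symm) ?_)
  exact ((((tendsto_qShift h5 _).mul (tendsto_qShift h5 _)).mul (tendsto_qShift h5 _)).mul
    (tendsto_qShift h5 _)).mul (tendsto_qShift h5 _)

theorem qShiftInf_pow_five_ne_zero {q : ℂ} (hq : ‖q‖ < 1) {n : ℕ} (hn : n ≠ 0) :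
    qShiftInf (q ^ n) (q ^ 5) ≠ 0 :=
  have h5 := norm_pow_lt_one hq (n := 5) (by norm_num)
  qShiftInf_ne_zero h5 (one_sub_mul_pow_ne_zero h5 (norm_pow_lt_one hq hn))

/-- Triple product with p = q^5, z = q^4, w = q: the k-th terms of its two series have exponents
(5k² + 3k)/2 and that plus 2k + 1. -/
theorem tsum_unitWeightQ {q : ℂ} (hq : ‖q‖ < 1) (hq0 : q ≠ 0) :
    ∑' k : ℕ, unitWeightQ q k * q ^ (2 * (k ^ 2 + 1 * k))
      = qShiftInf (q ^ 4) (q ^ 5) * qShiftInf q (q ^ 5) * qShiftInf (q ^ 5) (q ^ 5) := by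
  have h5 := norm_pow_lt_one hq (n := 5) (by norm_num)
  rw [← jacobi_triple_product h5 (by ring) (pow_ne_zero 5 hq0),
    ← (summable_norm_theta h5 _).of_norm.tsum_sub (summable_norm_theta_succ h5 _).of_norm]
  refine tsum_congr fun k => ?_
  rw [unitWeightQ, sq_eq_two_mul_choose_add, choose_succ_two]
  ring

theorem tsum_unitWeightOne {q : ℂ} (hq : ‖q‖ < 1) (hq0 : q ≠ 0) :
    ∑' k : ℕ, unitWeightOne q k * q ^ (2 * (k ^ 2 + 0 * k))
      = qShiftInf (q ^ 3) (q ^ 5) * qShiftInf (q ^ 2) (q ^ 5) * qShiftInf (q ^ 5) (q ^ 5) := by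
  have h5 := norm_pow_lt_one hq (n := 5) (by norm_num)
  have hs := (tsum_pow_sq_add_div hq 0 _ (norm_unitWeightOne_le hq) (sum_unitWeightOne hq)).1.of_norm
  have hz := (summable_norm_theta h5 (q ^ 3)).of_norm
  -- The weight at k = 0 is 1, not 2, so that term is split off; afterwards index k + 1 of the
  -- z-series pairs with index k of the w-series.
  rw [← jacobi_triple_product h5 (by ring) (pow_ne_zero 5 hq0), hs.tsum_eq_zero_add,
    hz.tsum_eq_zero_add, add_sub_assoc,
    ← ((summable_nat_add_iff 1).mpr hz).tsum_sub (summable_norm_theta_succ h5 _).of_norm]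
  congr 1
  · simp [unitWeightOne]
  refine tsum_congr fun k => ?_
  rw [unitWeightOne, if_neg (by omega), sq_eq_two_mul_choose_add]
  ring

/-- The series `∑_n q^{n² + m n} / (q; q)_n`. -/
noncomputable def rogersSeries (q : ℂ) (m : ℕ) : ℂ :=
  ∑' n : ℕ, q ^ (n ^ 2 + m * n) * (qShift q q n)⁻¹

/-- The first Rogers-Ramanujan identity. -/
theorem rogersSeries_zero {q : ℂ} (hq : ‖q‖ < 1) (hq0 : q ≠ 0) :
    rogersSeries q 0 = (qShiftInf q (q ^ 5) * qShiftInf (q ^ 4) (q ^ 5))⁻¹ := by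
  rw [rogersSeries,
    (tsum_pow_sq_add_div hq 0 _ (norm_unitWeightOne_le hq) (sum_unitWeightOne hq)).2,
    tsum_unitWeightOne hq hq0, qShiftInf_five hq]
  have h1 := qShiftInf_pow_five_ne_zero hq one_ne_zero
  have h2 := qShiftInf_pow_five_ne_zero hq two_ne_zero
  have h3 := qShiftInf_pow_five_ne_zero hq three_ne_zero
  have h4 := qShiftInf_pow_five_ne_zero hq four_ne_zero
  have h5 := qShiftInf_pow_five_ne_zero hq (n := 5) (by norm_num)
  rw [pow_one] at h1
  field_simp

/-- The second Rogers-Ramanujan identity. -/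
theorem rogersSeries_one {q : ℂ} (hq : ‖q‖ < 1) (hq0 : q ≠ 0) :
    rogersSeries q 1 = (qShiftInf (q ^ 2) (q ^ 5) * qShiftInf (q ^ 3) (q ^ 5))⁻¹ := by
  rw [rogersSeries,
    (tsum_pow_sq_add_div hq 1 _ (norm_unitWeightQ_le hq) (sum_unitWeightQ hq)).2,
    tsum_unitWeightQ hq hq0, qShiftInf_five hq]
  have h1 := qShiftInf_pow_five_ne_zero hq one_ne_zero
  have h2 := qShiftInf_pow_five_ne_zero hq two_ne_zero
  have h3 := qShiftInf_pow_five_ne_zero hq three_ne_zero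
  have h4 := qShiftInf_pow_five_ne_zero hq four_ne_zero
  have h5 := qShiftInf_pow_five_ne_zero hq (n := 5) (by norm_num)
  rw [pow_one] at h1
  field_simp

/-- In the difference of the series for m and m + 1, the factor 1 - q^n kills n = 0 and cancels the
last factor of (q; q)_n; then shift n. -/
theorem rogersSeries_eq_add {q : ℂ} (hq : ‖q‖ < 1) (m : ℕ) :
    rogersSeries q m = rogersSeries q (m + 1) + q ^ (m + 1) * rogersSeries q (m + 2) := by
  have hs := fun e => (summable_pow_sq_add_div hq e).of_norm
  rw [← sub_eq_iff_eq_add', rogersSeries, rogersSeries, ← (hs m).tsum_sub (hs (m + 1)),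
    ((hs m).sub (hs (m + 1))).tsum_eq_zero_add, rogersSeries, ← tsum_mul_left]
  simp only [mul_zero, sub_self, zero_add]
  refine tsum_congr fun n => ?_
  rw [qShift_succ]
  have h1 := qShift_self_ne_zero hq n
  have h2 := one_sub_mul_pow_ne_zero hq hq n
  field_simp
  ring

/-- Both sides satisfy u_{m+2} = q^m u_m - u_{m+1}; the power of q normalises the series recurrence,
and the sign turns the Schur recurrence into this one. -/
theorem pow_mul_rogersSeries {q : ℂ} (hq : ‖q‖ < 1) (m : ℕ) :
    q ^ m.choose 2 * rogersSeries q m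
      = (-1) ^ m * (schurA q m * rogersSeries q 0 - schurB q m * rogersSeries q 1) := by
  induction m using Nat.twoStepInduction with
  | zero => simp [schurA_zero, schurB_zero]
  | one => simp [schurA_one, schurB_add_one, schurSum_zero hq]
  | more m h0 h1 =>
    rw [choose_succ_two (m + 1), schurA_rec hq, schurB_rec hq]
    have h2 := rogersSeries_eq_add hq m
    rw [choose_succ_two m] at h1 ⊢
    linear_combination q ^ m * h0 - h1 - q ^ m * q ^ m.choose 2 * h2

/-- The Garrett-Ismail-Stanton generalization of the Rogers-Ramanujan identities. -/
theorem rogersSeries_eq {q : ℂ} (hq : ‖q‖ < 1) (hq0 : q ≠ 0) (m : ℕ) :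
    rogersSeries q m
      = (-1) ^ m * q ^ (-(m.choose 2 : ℤ)) * schurA q m
            / (qShiftInf q (q ^ 5) * qShiftInf (q ^ 4) (q ^ 5))
          + (-1) ^ (m + 1) * q ^ (-(m.choose 2 : ℤ)) * schurB q m
            / (qShiftInf (q ^ 2) (q ^ 5) * qShiftInf (q ^ 3) (q ^ 5)) := by
  have h := pow_mul_rogersSeries hq m
  rw [rogersSeries_zero hq hq0, rogersSeries_one hq hq0] at h
  have h0 : q ^ m.choose 2 ≠ 0 := pow_ne_zero _ hq0
  apply mul_left_cancel₀ h0
  rw [h, zpow_neg, zpow_natCast, div_eq_mul_inv, div_eq_mul_inv]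
  linear_combination (-(-1) ^ m * (schurA q m * (qShiftInf q (q ^ 5) * qShiftInf (q ^ 4) (q ^ 5))⁻¹
    - schurB q m * (qShiftInf (q ^ 2) (q ^ 5) * qShiftInf (q ^ 3) (q ^ 5))⁻¹))
      * mul_inv_cancel₀ h0

/-! ### Summation of the double series -/

/-- Split (xq; q)_{a+j} at j and apply Cauchy's identity at xq^j; the prefactor 1/(xq; q)_j
completes the product to 1/(xq; q)_∞. -/
theorem hasSum_cauchy_shift {q : ℂ} (hq : ‖q‖ < 1) {x : ℂ} (hx : ∀ k : ℕ, 1 - x * q * q ^ k ≠ 0)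
    (j : ℕ) :
    (Summable fun a : ℕ =>
      ‖q ^ (a ^ 2 + a * j) * x ^ a / (qShift q q a * qShift (x * q) q (a + j))‖) ∧
    HasSum (fun a : ℕ => q ^ (a ^ 2 + a * j) * x ^ a / (qShift q q a * qShift (x * q) q (a + j)))
      (qShiftInf (x * q) q)⁻¹ := by
  have hx' : ∀ k : ℕ, 1 - x * q ^ j * q * q ^ k ≠ 0 := fun k => by
    have := hx (j + k)
    rwa [pow_add, show x * q * (q ^ j * q ^ k) = x * q ^ j * q * q ^ k by ring] at this
  obtain ⟨hs, ht⟩ := tsum_pow_sq_div_eq_inv hq (x * q ^ j) hx'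
  have hterm : ∀ a : ℕ, q ^ (a ^ 2 + a * j) * x ^ a / (qShift q q a * qShift (x * q) q (a + j))
      = (qShift (x * q) q j)⁻¹ * (q ^ a ^ 2 * (x * q ^ j) ^ a
        / (qShift q q a * qShift (x * q ^ j * q) q a)) := fun a => by
    rw [add_comm a j, qShift_add, show x * q * q ^ j = x * q ^ j * q by ring, mul_pow, ← pow_mul,
      pow_add, mul_comm a j]
    simp only [div_eq_mul_inv, mul_inv]
    ring
  simp only [hterm]
  constructor
  · simpa only [norm_mul] using hs.mul_left ‖(qShift (x * q) q j)⁻¹‖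
  · rw [qShiftInf_eq_mul hq _ j, mul_inv, show x * q * q ^ j = x * q ^ j * q by ring, ← ht]
    exact hs.of_norm.hasSum.mul_left _

/-- The general term of the triple series obtained by expanding `h_{m,n}`,
indexed by `(j, m - j, n - j)`. -/
noncomputable def tripleTerm (q x y : ℂ) (s : ℕ) (t : ℕ × ℕ × ℕ) : ℂ :=
  q ^ (t.1 ^ 2 + s * t.1) * (qShift q q t.1)⁻¹
    * ((q ^ (t.2.1 ^ 2 + t.2.1 * t.1) * x ^ t.2.1
          / (qShift q q t.2.1 * qShift (x * q) q (t.2.1 + t.1)))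
      * (q ^ (t.2.2 ^ 2 + t.2.2 * t.1) * y ^ t.2.2
          / (qShift q q t.2.2 * qShift (y * q) q (t.2.2 + t.1))))

/-- The bound is uniform in j because |q^(aj)| ≤ 1, so the triple series is dominated by a product
of three single series. -/
theorem exists_norm_cauchy_shift_le {q : ℂ} (hq : ‖q‖ < 1) {x : ℂ}
    (hx : ∀ k : ℕ, 1 - x * q * q ^ k ≠ 0) :
    ∃ C : ℝ, 0 ≤ C ∧ ∀ a j : ℕ,
      ‖q ^ (a ^ 2 + a * j) * x ^ a / (qShift q q a * qShift (x * q) q (a + j))‖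
        ≤ ‖q ^ a ^ 2 * x ^ a‖ * C := by
  obtain ⟨C₂, hC₂, h₂⟩ := exists_norm_le_of_tendsto
    (tendsto_inv_qShift hq (one_sub_mul_pow_ne_zero hq hq))
  obtain ⟨C₃, hC₃, h₃⟩ := exists_norm_le_of_tendsto (tendsto_inv_qShift hq hx)
  refine ⟨C₂ * C₃, by positivity, fun a j => ?_⟩
  rw [div_eq_mul_inv, norm_mul, mul_inv, norm_mul (qShift q q a)⁻¹, pow_add, norm_mul,
    norm_mul (q ^ a ^ 2), norm_mul (q ^ a ^ 2)]
  have h1 : ‖q ^ (a * j)‖ ≤ 1 := by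
    rw [norm_pow]
    exact pow_le_one₀ (norm_nonneg _) hq.le
  gcongr
  exacts [mul_le_of_le_one_right (norm_nonneg _) h1, h₂ a, h₃ _]

theorem summable_tripleTerm {q : ℂ} (hq : ‖q‖ < 1) {x y : ℂ}
    (hx : ∀ k : ℕ, 1 - x * q * q ^ k ≠ 0) (hy : ∀ k : ℕ, 1 - y * q * q ^ k ≠ 0) (s : ℕ) :
    Summable (tripleTerm q x y s) := by
  obtain ⟨C, hC, h₁⟩ := exists_norm_cauchy_shift_le hq hx
  obtain ⟨D, hD, h₂⟩ := exists_norm_cauchy_shift_le hq hy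
  have hAB := ((summable_norm_pow_sq_mul_pow hq x).mul_right C).mul_of_nonneg
    ((summable_norm_pow_sq_mul_pow hq y).mul_right D)
    (fun _ => mul_nonneg (norm_nonneg _) hC) (fun _ => mul_nonneg (norm_nonneg _) hD)
  have hT := (summable_pow_sq_add_div hq s).mul_of_nonneg hAB (fun _ => norm_nonneg _)
    (fun _ => mul_nonneg (mul_nonneg (norm_nonneg _) hC) (mul_nonneg (norm_nonneg _) hD))
  refine Summable.of_norm_bounded hT fun t => ?_
  rw [tripleTerm, norm_mul]
  refine mul_le_mul_of_nonneg_left ?_ (norm_nonneg _)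
  rw [norm_mul]
  exact mul_le_mul (h₁ _ _) (h₂ _ _) (norm_nonneg _) (mul_nonneg (norm_nonneg _) hC)

theorem hasSum_tripleTerm_right {q : ℂ} (hq : ‖q‖ < 1) {x y : ℂ}
    (hx : ∀ k : ℕ, 1 - x * q * q ^ k ≠ 0) (hy : ∀ k : ℕ, 1 - y * q * q ^ k ≠ 0) (s j : ℕ) :
    HasSum (fun ab : ℕ × ℕ => tripleTerm q x y s (j, ab))
      (q ^ (j ^ 2 + s * j) * (qShift q q j)⁻¹
        * ((qShiftInf (x * q) q)⁻¹ * (qShiftInf (y * q) q)⁻¹)) := by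
  obtain ⟨hA, hA'⟩ := hasSum_cauchy_shift hq hx j
  obtain ⟨hB, hB'⟩ := hasSum_cauchy_shift hq hy j
  have hAB := summable_mul_of_summable_norm hA hB
  have h := (hA'.mul hB' hAB).mul_left (q ^ (j ^ 2 + s * j) * (qShift q q j)⁻¹)
  exact h.congr_fun fun ab => by simp only [tripleTerm]

theorem hasSum_tripleTerm {q : ℂ} (hq : ‖q‖ < 1) {x y : ℂ}
    (hx : ∀ k : ℕ, 1 - x * q * q ^ k ≠ 0) (hy : ∀ k : ℕ, 1 - y * q * q ^ k ≠ 0) (s : ℕ) :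
    HasSum (tripleTerm q x y s)
      (1 / (qShiftInf (x * q) q * qShiftInf (y * q) q) * rogersSeries q s) := by
  have h := (summable_tripleTerm hq hx hy s).hasSum
  have h2 := h.prod_fiberwise (hasSum_tripleTerm_right hq hx hy s)
  have h3 := (summable_pow_sq_add_div hq s).of_norm.hasSum.mul_right
    ((qShiftInf (x * q) q)⁻¹ * (qShiftInf (y * q) q)⁻¹)
  rw [h2.unique h3] at h
  rwa [rogersSeries, one_div, mul_inv, mul_comm]

/-- The summand of the double series at `(m, n)`, restricted to the `j`-th term of `h_{m,n}`. -/
theorem term_eq_tripleTerm {q c d : ℂ} (hq : ‖q‖ < 1) (hq0 : q ≠ 0) {s : ℕ}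
    (hcd : c * d = -q ^ s) (z₁ z₂ : ℂ) (a b j : ℕ) :
    q ^ (((a + j : ℕ) : ℤ) ^ 2 - ((a + j : ℕ) : ℤ) * ((b + j : ℕ) : ℤ) + ((b + j : ℕ) : ℤ) ^ 2)
        * (gaussBinom q (a + j) j * gaussBinom q (b + j) j * q ^ (a * b) * (-1) ^ j * qShift q q j
          * z₁ ^ a * z₂ ^ b)
        / ((qShift q q (a + j) * qShift (c * z₁ * q) q (a + j))
            * (qShift q q (b + j) * qShift (d * z₂ * q) q (b + j)))
        * c ^ (a + j) * d ^ (b + j)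
      = tripleTerm q (c * z₁) (d * z₂) s (j, a, b) := by
  have hz : q ^ (((a + j : ℕ) : ℤ) ^ 2 - ((a + j : ℕ) : ℤ) * ((b + j : ℕ) : ℤ)
      + ((b + j : ℕ) : ℤ) ^ 2) * q ^ (a * b)
      = q ^ j ^ 2 * q ^ (a ^ 2 + a * j) * q ^ (b ^ 2 + b * j) := by
    rw [← zpow_natCast q (a * b), ← zpow_add₀ hq0, ← pow_add, ← pow_add, ← zpow_natCast q]
    congr 1
    push_cast
    ring
  have hcd' : c ^ j * d ^ j = (-1) ^ j * q ^ (s * j) := by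
    rw [← mul_pow, hcd, neg_pow, ← pow_mul]
  have hsign : (-1 : ℂ) ^ j * (-1) ^ j = 1 := by rw [← mul_pow]; simp
  have hg : ∀ n, gaussBinom q (n + j) j * (qShift q q (n + j))⁻¹
      = (qShift q q n)⁻¹ * (qShift q q j)⁻¹ := fun n => by
    have h1 := qShift_self_ne_zero hq (n + j)
    rw [gaussBinom_of_le q (Nat.le_add_left j n), Nat.add_sub_cancel]
    field_simp
  have hga := hg a
  have hgb := hg b
  have hj := mul_inv_cancel₀ (qShift_self_ne_zero hq j)
  simp only [tripleTerm]
  rw [pow_add c, pow_add d, pow_add q (j ^ 2), mul_pow, mul_pow]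
  simp only [div_eq_mul_inv, mul_inv]
  generalize q ^ (((a + j : ℕ) : ℤ) ^ 2 - ((a + j : ℕ) : ℤ) * ((b + j : ℕ) : ℤ)
      + ((b + j : ℕ) : ℤ) ^ 2) = Z at hz ⊢
  generalize (qShift (c * z₁ * q) q (a + j))⁻¹ = A
  generalize (qShift (d * z₂ * q) q (b + j))⁻¹ = B
  generalize (qShift q q (a + j))⁻¹ = U at hga ⊢
  generalize (qShift q q (b + j))⁻¹ = V at hgb ⊢
  generalize (qShift q q a)⁻¹ = U' at hga ⊢
  generalize (qShift q q b)⁻¹ = V' at hgb ⊢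
  generalize gaussBinom q (a + j) j = g at hga ⊢
  generalize gaussBinom q (b + j) j = g' at hgb ⊢
  generalize (qShift q q j)⁻¹ = Q' at hga hgb hj ⊢
  generalize qShift q q j = Q at hj ⊢
  generalize (-1 : ℂ) ^ j = ε at hsign hcd' ⊢
  generalize q ^ (a ^ 2 + a * j) = X at hz ⊢
  generalize q ^ (b ^ 2 + b * j) = Y at hz ⊢
  generalize q ^ j ^ 2 = R at hz ⊢
  generalize q ^ (s * j) = S at hcd' ⊢
  generalize q ^ (a * b) = T at hz ⊢
  generalize c ^ j = cj at hcd' ⊢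
  generalize d ^ j = dj at hcd' ⊢
  generalize c ^ a = ca
  generalize d ^ b = db
  generalize z₁ ^ a = z₁a
  generalize z₂ ^ b = z₂b
  calc _ = (Z * T) * (cj * dj) * ε * (g * U) * (g' * V) * Q
        * (ca * z₁a * (db * z₂b)) * A * B := by ring
    _ = (R * X * Y) * S * (ε * ε) * (Q * Q') * (U' * V' * Q')
        * (ca * z₁a * (db * z₂b)) * A * B := by rw [hz, hcd', hga, hgb]; ring
    _ = _ := by rw [hsign, hj]; ring

theorem mainTheorem10 (q c d z₁ z₂ : ℂ) (hq0 : 0 < ‖q‖) (hq1 : ‖q‖ < 1) (s : ℕ)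
    (hcd : c * d = -q ^ s)
    (hc : ∀ r : ℕ, c * z₁ ≠ q ^ (-(r : ℤ)))
    (hd : ∀ r : ℕ, d * z₂ ≠ q ^ (-(r : ℤ))) :
    HasSum
      (fun p : ℕ × ℕ =>
        q ^ ((p.1 : ℤ) ^ 2 - (p.1 : ℤ) * (p.2 : ℤ) + (p.2 : ℤ) ^ 2) * hPoly q p.1 p.2 z₁ z₂
          / ((qShift q q p.1 * qShift (c * z₁ * q) q p.1)
              * (qShift q q p.2 * qShift (d * z₂ * q) q p.2))
          * c ^ p.1 * d ^ p.2)
      (1 / (qShiftInf (c * z₁ * q) q * qShiftInf (d * z₂ * q) q)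
        * ((-1) ^ s * q ^ (-(s.choose 2 : ℤ)) * schurA q s
              / (qShiftInf q (q ^ 5) * qShiftInf (q ^ 4) (q ^ 5))
            + (-1) ^ (s + 1) * q ^ (-(s.choose 2 : ℤ)) * schurB q s
              / (qShiftInf (q ^ 2) (q ^ 5) * qShiftInf (q ^ 3) (q ^ 5)))) := by
  have hne : q ≠ 0 := norm_pos_iff.mp hq0
  have hne' : ∀ w : ℂ, (∀ r : ℕ, w ≠ q ^ (-(r : ℤ))) → ∀ k : ℕ, 1 - w * q * q ^ k ≠ 0 := by
    intro w hw k h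
    refine hw (k + 1) ?_
    rw [zpow_neg, zpow_natCast, ← one_div, eq_div_iff (pow_ne_zero _ hne)]
    linear_combination -h
  have hT := hasSum_tripleTerm hq1 (hne' _ hc) (hne' _ hd) s
  rw [rogersSeries_eq hq1 hne] at hT
  -- `G` extends the triple series by zero to all ((m, n), j), so that summing over j first gives
  -- the finite sum in `hPoly`. `HasSum` over ℕ × ℕ is unconditional, which in ℂ means absolute
  -- convergence.
  let G : (ℕ × ℕ) × ℕ → ℂ := fun u =>
    if u.2 ≤ min u.1.1 u.1.2 then tripleTerm q (c * z₁) (d * z₂) s (u.2, u.1.1 - u.2, u.1.2 - u.2)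
    else 0
  let φ : ℕ × ℕ × ℕ → (ℕ × ℕ) × ℕ := fun t => ((t.2.1 + t.1, t.2.2 + t.1), t.1)
  have hφ : Function.Injective φ := by
    rintro ⟨j, a, b⟩ ⟨j', a', b'⟩ h
    simp only [φ, Prod.mk.injEq] at h ⊢
    omega
  have hGφ : G ∘ φ = tripleTerm q (c * z₁) (d * z₂) s := by
    ext ⟨j, a, b⟩
    simp [G, φ]
  have hG0 : ∀ u ∉ Set.range φ, G u = 0 := by
    rintro ⟨⟨m, n⟩, j⟩ hu
    refine if_neg fun h => hu ⟨(j, m - j, n - j), ?_⟩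
    change ((m - j + j, n - j + j), j) = ((m, n), j)
    have h1 : j ≤ m := h.trans (min_le_left m n)
    have h2 : j ≤ n := h.trans (min_le_right m n)
    rw [Nat.sub_add_cancel h1, Nat.sub_add_cancel h2]
  rw [← hGφ, hφ.hasSum_iff hG0] at hT
  refine hT.prod_fiberwise fun p => ?_
  have hsum : q ^ ((p.1 : ℤ) ^ 2 - (p.1 : ℤ) * (p.2 : ℤ) + (p.2 : ℤ) ^ 2) * hPoly q p.1 p.2 z₁ z₂
          / ((qShift q q p.1 * qShift (c * z₁ * q) q p.1)
              * (qShift q q p.2 * qShift (d * z₂ * q) q p.2))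
          * c ^ p.1 * d ^ p.2 = ∑ j ∈ range (min p.1 p.2 + 1), G (p, j) := by
    rw [hPoly, mul_sum, sum_div, sum_mul, sum_mul]
    refine sum_congr rfl fun j hj => ?_
    have hj' : j ≤ min p.1 p.2 := Nat.lt_succ_iff.mp (mem_range.mp hj)
    obtain ⟨m, n⟩ := p
    obtain ⟨a, rfl⟩ := Nat.exists_eq_add_of_le' (hj'.trans (min_le_left _ _))
    obtain ⟨b, rfl⟩ := Nat.exists_eq_add_of_le' (hj'.trans (min_le_right _ _))
    simp only [G, if_pos hj', Nat.add_sub_cancel]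
    exact term_eq_tripleTerm hq1 hne hcd z₁ z₂ a b j
  rw [hsum]
  refine hasSum_sum_of_ne_finset_zero fun j hj => if_neg ?_
  simpa [Nat.lt_succ_iff] using hj
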